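/- Notation. On $\mathbb{C}^{2n}=T^*\mathbb{C}^n$ with coordinates $(z^1,\dots,z^n,w_1,\dots,w_n)$ let $\Omega=\sum_i dz^i\wedge dw_i$, let $\tau$ be complex conjugation, $\gamma=\sqrt{-1}\,\Omega(\cdot,\tau\cdot)$ and $\lambda=\sum_i w_i\,dz^i$; write $z^tw=\sum_i z^iw_i$. Let $G_{SK}=\mathrm{Sp}(\mathbb{R}^{2n})\ltimes \mathrm{Heis}_{2n+1}(\mathbb{C})$ be the group of triples $(X,s,v)$ with $X\in \mathrm{Sp}(\mathbb{R}^{2n})$, $s\in\mathbb{C}$, $v\in\mathbb{C}^{2n}$ and product $$(X,s,v)\cdot(X',s',v')=\bigl(XX',\ s+s'+\tfrac12\Omega(v,Xv'),\ Xv'+v\bigr),$$ and let $\bar\rho(X,s,v)\,q=Xq+v$ for $q\in\mathbb{C}^{2n}$. An affine special Kähler manifold $(M,J,g,\nabla)$ is a pseudo-Kähler manifold $(M,J,g)$ with symplectic form $\omega=g(\cdot,J\cdot)$, together with a flat torsion-free connection $\nabla$ such that $\nabla\omega=0$ and $d^\nabla J=0$. For $U\subset M$ open, a special Kähler pair of $U$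 is a pair $(\phi,F)$ where $\phi=(z,w):U\to\mathbb{C}^{2n}$ is a holomorphic immersion with $\phi^*\Omega=0$ and $\phi^*\gamma$ non-degenerate which induces on $U$ the restriction of the special Kähler structure (that is, $g=\mathrm{Re}\,\phi^*\gamma$ and $\nabla$ is the pullback of the flat connection of $\mathbb{R}^{2n}$ under the local diffeomorphism $\mathrm{Re}\,\phi:U\to\mathbb{R}^{2n}$), and $F:U\to\mathbb{C}$ is a function with $dF=\phi^*\lambda$. Let $\mathcal{F}(U)$ be the set of special Kähler pairs of $U$. Proposition. Let $M$ be a connected affine special Kähler manifold of complex dimension $n$ and let $U\subset M$ be an open subset with $\mathcal{F}(U)\neq\emptyset$. For $x=(X,s,v)\in G_{SK}$ and $(\phi,F)\in\mathcal{F}(U)$ with $\phi=(z,w)$, put $x\phi:=\bar\rho(x)\circ\phi=:(z',w')$ and $$x\cdot F:=F-\tfrac12 z^tw+\tfrac12 z'^tw'+\tfrac12\,\Omega(x\phi,v)-s .$$ Then $x\cdot(\phi,F):=(x\phi,\,x\cdot F)$ is again a special Kähler pair of $U$, and this defines an action of $G_{SK}$ on $\mathcal{F}(U)$. The action is free if $U$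 is non-empty, and it is simply transitive if $U$ is non-empty and connected: for all $(\phi,F),(\phi',F')\in\mathcal{F}(U)$ there is exactly one $x\in G_{SK}$ with $x\cdot(\phi,F)=(\phi',F')$. -/

import Mathlib

open scoped Manifold ContDiff
open Bundle

/-! ### The complex symplectic vector space `ℂ²ⁿ = T*ℂⁿ` -/

/-- The model space `ℂⁿ` of complex manifolds of complex dimension `n`. -/
abbrev Cn (n : ℕ) : Type := EuclideanSpace ℂ (Fin n)

/-- `ℂ²ⁿ` with canonical coordinates: `q (Sum.inl i)` is `zⁱ` and `q (Sum.inr i)` is `wᵢ`. -/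
abbrev C2n (n : ℕ) : Type := Fin n ⊕ Fin n → ℂ

/-- `ℝ²ⁿ`, the real points of `ℂ²ⁿ`. -/
abbrev R2n (n : ℕ) : Type := Fin n ⊕ Fin n → ℝ

namespace C2n

variable {n : ℕ}

/-- The real part `Re : ℂ²ⁿ → ℝ²ⁿ`, componentwise. -/
def re (a : C2n n) : R2n n := fun k => (a k).re

/-- The standard real structure `τ` of `ℂ²ⁿ`, i.e. componentwise complex conjugation. -/
def tau (a : C2n n) : C2n n := fun k => (starRingEnd ℂ) (a k)

/-- The standard complex symplectic form `Ω = ∑ dzⁱ ∧ dwᵢ`. -/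
def Omega (a b : C2n n) : ℂ :=
  ∑ i : Fin n, (a (Sum.inl i) * b (Sum.inr i) - a (Sum.inr i) * b (Sum.inl i))

/-- The Hermitian form `γ = √-1 Ω(·, τ ·)`. -/
noncomputable def gamma (a b : C2n n) : ℂ := Complex.I * Omega a (tau b)

/-- The Liouville form `λ = wᵗ dz = ∑ wᵢ dzⁱ`, at the point `q`, evaluated at the vector `a`. -/
def liouville (q a : C2n n) : ℂ := ∑ i : Fin n, q (Sum.inr i) * a (Sum.inl i)

/-- The function `zᵗ w = ∑ zⁱ wᵢ` on `ℂ²ⁿ`. -/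
def zw (q : C2n n) : ℂ := ∑ i : Fin n, q (Sum.inl i) * q (Sum.inr i)

lemma Omega_eq (a b : C2n n) : Omega a b = -(a ⬝ᵥ (Matrix.J (Fin n) ℂ).mulVec b) := by
  simp only [Omega, Matrix.J, Matrix.fromBlocks_mulVec, dotProduct, Fintype.sum_sum_type,
    Sum.elim_inl, Sum.elim_inr, Matrix.zero_mulVec, Matrix.neg_mulVec, Matrix.one_mulVec,
    Pi.neg_apply, Function.comp_apply, zero_add, add_zero, Finset.sum_sub_distrib]
  simp [sub_eq_neg_add, add_comm]

lemma Omega_add_left (a b c : C2n n) : Omega (a + b) c = Omega a c + Omega b c := by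
  simp only [Omega_eq, add_dotProduct]; ring

lemma Omega_add_right (a b c : C2n n) : Omega a (b + c) = Omega a b + Omega a c := by
  simp only [Omega_eq, Matrix.mulVec_add, dotProduct_add]; ring

lemma Omega_neg_right (a b : C2n n) : Omega a (-b) = -Omega a b := by
  simp only [Omega_eq, Matrix.mulVec_neg, dotProduct_neg]

lemma Omega_neg_left (a b : C2n n) : Omega (-a) b = -Omega a b := by
  simp only [Omega_eq, neg_dotProduct]

lemma Omega_self (a : C2n n) : Omega a a = 0 := by
  simp only [Omega]
  exact Finset.sum_eq_zero fun i _ => by ring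

end C2n

/-! ### The group `G_SK = Sp(ℝ²ⁿ) ⋉ Heis_{2n+1}(ℂ)` -/

/-- The linear action of `Sp(ℝ²ⁿ)` on `ℂ²ⁿ`. -/
def spAct {n : ℕ} (X : Matrix.symplecticGroup (Fin n) ℝ) (a : C2n n) : C2n n :=
  ((X : Matrix (Fin n ⊕ Fin n) (Fin n ⊕ Fin n) ℝ).map Complex.ofReal).mulVec a

section spAct

variable {n : ℕ} (X X' : Matrix.symplecticGroup (Fin n) ℝ) (a b : C2n n)

lemma spAct_one : spAct 1 a = a := by
  have h : ((1 : Matrix (Fin n ⊕ Fin n) (Fin n ⊕ Fin n) ℝ).map Complex.ofReal) = 1 :=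
    Matrix.map_one _ Complex.ofReal_zero Complex.ofReal_one
  simp only [spAct, OneMemClass.coe_one, h, Matrix.one_mulVec]

lemma spAct_mul : spAct (X * X') a = spAct X (spAct X' a) := by
  have h : ((X * X' : Matrix.symplecticGroup (Fin n) ℝ) :
      Matrix (Fin n ⊕ Fin n) (Fin n ⊕ Fin n) ℝ).map Complex.ofReal
      = (X : Matrix (Fin n ⊕ Fin n) (Fin n ⊕ Fin n) ℝ).map Complex.ofReal
        * (X' : Matrix (Fin n ⊕ Fin n) (Fin n ⊕ Fin n) ℝ).map Complex.ofReal :=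
    Matrix.map_mul (f := Complex.ofRealHom)
  simp only [spAct, h, Matrix.mulVec_mulVec]

lemma spAct_add : spAct X (a + b) = spAct X a + spAct X b := Matrix.mulVec_add _ _ _

lemma spAct_neg : spAct X (-a) = -spAct X a := Matrix.mulVec_neg _ _

lemma Omega_spAct : C2n.Omega (spAct X a) (spAct X b) = C2n.Omega a b := by
  have h : (X : Matrix (Fin n ⊕ Fin n) (Fin n ⊕ Fin n) ℝ).transpose * Matrix.J (Fin n) ℝ
      * (X : Matrix (Fin n ⊕ Fin n) (Fin n ⊕ Fin n) ℝ) = Matrix.J (Fin n) ℝ :=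
    SymplecticGroup.mem_iff'.mp X.2
  have h2 := congrArg (fun A => Matrix.map A Complex.ofRealHom) h
  simp only [Matrix.map_mul, Matrix.map_J, Matrix.transpose_map] at h2
  rw [C2n.Omega_eq, C2n.Omega_eq]
  change -(((X : Matrix (Fin n ⊕ Fin n) (Fin n ⊕ Fin n) ℝ).map Complex.ofRealHom).mulVec a ⬝ᵥ
    (Matrix.J (Fin n) ℂ).mulVec
      (((X : Matrix (Fin n ⊕ Fin n) (Fin n ⊕ Fin n) ℝ).map Complex.ofRealHom).mulVec b)) = _
  rw [← Matrix.vecMul_transpose, ← Matrix.dotProduct_mulVec, Matrix.mulVec_mulVec,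
    Matrix.mulVec_mulVec, h2]

end spAct

/-- The group `G_SK = Sp(ℝ²ⁿ) ⋉ Heis_{2n+1}(ℂ)`, the set of triples `(X, s, v)` with
`X ∈ Sp(ℝ²ⁿ)`, `s ∈ ℂ`, `v ∈ ℂ²ⁿ`. -/
@[ext]
structure GSK (n : ℕ) where
  X : Matrix.symplecticGroup (Fin n) ℝ
  s : ℂ
  v : C2n n

namespace GSK

variable {n : ℕ}

/-- `(X, s, v) (X', s', v') = (X X', s + s' + ½ Ω(v, X v'), X v' + v)`. -/
noncomputable instance : Mul (GSK n) where
  mul x y := ⟨x.X * y.X, x.s + y.s + 1 / 2 * C2n.Omega x.v (spAct x.X y.v), spAct x.X y.v + x.v⟩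

instance : One (GSK n) where
  one := ⟨1, 0, 0⟩

noncomputable instance : Inv (GSK n) where
  inv x := ⟨x.X⁻¹, -x.s, -spAct x.X⁻¹ x.v⟩

lemma mul_def (x y : GSK n) : x * y =
    ⟨x.X * y.X, x.s + y.s + 1 / 2 * C2n.Omega x.v (spAct x.X y.v), spAct x.X y.v + x.v⟩ := rfl

lemma one_def : (1 : GSK n) = ⟨1, 0, 0⟩ := rfl

lemma inv_def (x : GSK n) : x⁻¹ = ⟨x.X⁻¹, -x.s, -spAct x.X⁻¹ x.v⟩ := rfl

noncomputable instance : Group (GSK n) :=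
  Group.ofLeftAxioms
    (by
      intro x y z
      simp only [mul_def, GSK.mk.injEq]
      refine ⟨mul_assoc _ _ _, ?_, ?_⟩
      · simp only [spAct_mul, spAct_add, C2n.Omega_add_left, C2n.Omega_add_right, Omega_spAct]
        ring
      · simp only [spAct_mul, spAct_add, add_assoc])
    (by
      intro x
      ext1
      · simp [mul_def, one_def]
      · simp [mul_def, one_def, C2n.Omega]
      · simp [mul_def, one_def, spAct_one])
    (by
      intro x
      simp only [mul_def, inv_def, one_def, GSK.mk.injEq]
      refine ⟨inv_mul_cancel _, ?_, add_neg_cancel _⟩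
      rw [C2n.Omega_neg_left, C2n.Omega_self]
      ring)

/-- The affine representation `ρ̄` of `G_SK` on `ℂ²ⁿ`: `ρ̄(X, s, v) q = X q + v`. -/
def rhoBar (x : GSK n) (q : C2n n) : C2n n := spAct x.X q + x.v

end GSK

/-! ### Complex manifolds as real manifolds -/

section Manifold

variable {n : ℕ} {M : Type*} [TopologicalSpace M] [ChartedSpace (Cn n) M]

/-- A complex manifold is a (real-analytic, hence smooth) real manifold. -/
instance isManifold_real_of_complex [IsManifold 𝓘(ℂ, Cn n) ω M] :
    IsManifold 𝓘(ℝ, Cn n) ω M := by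
  apply isManifold_of_contDiffOn
  intro e e' he he'
  have h := (contDiffGroupoid ω 𝓘(ℂ, Cn n)).compatible he he'
  rw [contDiffGroupoid, mem_groupoid_of_pregroupoid] at h
  exact h.1.restrict_scalars ℝ

/-- The complex structure `J` on the real tangent bundle of a complex manifold: multiplication
by `√-1` in any holomorphic chart (the tangent space at `p` is read in the chart at `p`). -/
noncomputable def cplxJ (p : M) :
    TangentSpace 𝓘(ℝ, Cn n) p →L[ℝ] TangentSpace 𝓘(ℝ, Cn n) p :=
  ((Complex.I • ContinuousLinearMap.id ℂ (Cn n)).restrictScalars ℝ : Cn n →L[ℝ] Cn n)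

/-- A smooth vector field on `M`. -/
def SmoothVF [IsManifold 𝓘(ℂ, Cn n) ω M] (Y : Π p : M, TangentSpace 𝓘(ℝ, Cn n) p) : Prop :=
  ContMDiff 𝓘(ℝ, Cn n) 𝓘(ℝ, Cn n).tangent ∞
    (fun p => (⟨p, Y p⟩ : TangentBundle 𝓘(ℝ, Cn n) M))

end Manifold

/-- The differential at `p ∈ U` of a map `f` defined on an open subset `U` of `M`, as a real linear
map on `T_p M`; `T_p U` is identified with `T_p M` by the differential of the inclusion. -/
noncomputable def diffOn (n : ℕ) {M : Type*} [TopologicalSpace M] [ChartedSpace (Cn n) M]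
    {V : Type*} [NormedAddCommGroup V] [NormedSpace ℝ V]
    {U : TopologicalSpace.Opens M} (f : U → V) (p : U) :
    TangentSpace 𝓘(ℝ, Cn n) (p : M) →L[ℝ] V :=
  (mvfderiv 𝓘(ℝ, Cn n) f p) ∘L
    (mfderiv 𝓘(ℝ, Cn n) 𝓘(ℝ, Cn n) (Subtype.val : U → M) p).inverse

/-! ### Affine special Kähler manifolds -/

section ASK

variable (n : ℕ) (M : Type*) [TopologicalSpace M] [ChartedSpace (Cn n) M]
  [IsManifold 𝓘(ℂ, Cn n) ω M]

/-- An affine special Kähler structure `(g, ∇)` on the complex manifold `(M, J)`: `(M, J, g)` is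
pseudo-Kähler with symplectic form `ω = g(·, J·)`, and `∇` is a flat torsion-free
connection with `∇ω = 0` and `d^∇ J = 0`. Mathlib writes `conn Y p u` for `(∇_u Y)(p)`. -/
structure AffineSpecialKahler where
  /-- the pseudo-Riemannian metric -/
  g : Π p : M, TangentSpace 𝓘(ℝ, Cn n) p →L[ℝ] TangentSpace 𝓘(ℝ, Cn n) p →L[ℝ] ℝ
  /-- the special connection `∇` -/
  conn : CovariantDerivative 𝓘(ℝ, Cn n) (Cn n) (TangentSpace 𝓘(ℝ, Cn n) : M → Type _)
  g_smooth : ContMDiff 𝓘(ℝ, Cn n) (𝓘(ℝ, Cn n).prod 𝓘(ℝ, Cn n →L[ℝ] Cn n →L[ℝ] ℝ)) ∞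
    (fun p => TotalSpace.mk' (Cn n →L[ℝ] Cn n →L[ℝ] ℝ) p (g p))
  g_symm : ∀ p u v, g p u v = g p v u
  g_nondegenerate : ∀ p u, (∀ v, g p u v = 0) → u = 0
  g_hermitian : ∀ p u v, g p (cplxJ p u) (cplxJ p v) = g p u v
  /-- `dω = 0` -/
  omega_closed : ∀ X Y Z : Π p : M, TangentSpace 𝓘(ℝ, Cn n) p,
    SmoothVF X → SmoothVF Y → SmoothVF Z → ∀ p : M,
      mvfderiv 𝓘(ℝ, Cn n) (fun q => g q (Y q) (cplxJ q (Z q))) p (X p)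
      - mvfderiv 𝓘(ℝ, Cn n) (fun q => g q (X q) (cplxJ q (Z q))) p (Y p)
      + mvfderiv 𝓘(ℝ, Cn n) (fun q => g q (X q) (cplxJ q (Y q))) p (Z p)
      - g p (VectorField.mlieBracket 𝓘(ℝ, Cn n) X Y p) (cplxJ p (Z p))
      + g p (VectorField.mlieBracket 𝓘(ℝ, Cn n) X Z p) (cplxJ p (Y p))
      - g p (VectorField.mlieBracket 𝓘(ℝ, Cn n) Y Z p) (cplxJ p (X p)) = 0
  conn_smooth : CovariantDerivative.ContMDiffCovariantDerivative conn ∞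
  /-- `∇_X Y - ∇_Y X = [X, Y]` -/
  conn_torsionFree : ∀ X Y : Π p : M, TangentSpace 𝓘(ℝ, Cn n) p,
    SmoothVF X → SmoothVF Y → ∀ p : M,
      conn Y p (X p) - conn X p (Y p) = VectorField.mlieBracket 𝓘(ℝ, Cn n) X Y p
  /-- `∇_X ∇_Y Z - ∇_Y ∇_X Z - ∇_[X,Y] Z = 0` -/
  conn_flat : ∀ X Y Z : Π p : M, TangentSpace 𝓘(ℝ, Cn n) p,
    SmoothVF X → SmoothVF Y → SmoothVF Z → ∀ p : M,
      conn (fun q => conn Z q (Y q)) p (X p) - conn (fun q => conn Z q (X q)) p (Y p)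
      - conn Z p (VectorField.mlieBracket 𝓘(ℝ, Cn n) X Y p) = 0
  /-- `∇ω = 0`, i.e. `X (ω(Y, Z)) = ω(∇_X Y, Z) + ω(Y, ∇_X Z)` -/
  conn_omega : ∀ X Y Z : Π p : M, TangentSpace 𝓘(ℝ, Cn n) p,
    SmoothVF X → SmoothVF Y → SmoothVF Z → ∀ p : M,
      mvfderiv 𝓘(ℝ, Cn n) (fun q => g q (Y q) (cplxJ q (Z q))) p (X p)
      = g p (conn Y p (X p)) (cplxJ p (Z p)) + g p (Y p) (cplxJ p (conn Z p (X p)))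
  /-- `d^∇ J = 0`, i.e. `∇_X (J Y) - ∇_Y (J X) - J [X, Y] = 0` -/
  conn_J : ∀ X Y : Π p : M, TangentSpace 𝓘(ℝ, Cn n) p,
    SmoothVF X → SmoothVF Y → ∀ p : M,
      conn (fun q => cplxJ q (Y q)) p (X p) - conn (fun q => cplxJ q (X q)) p (Y p)
      - cplxJ p (VectorField.mlieBracket 𝓘(ℝ, Cn n) X Y p) = 0

end ASK

/-! ### Special Kähler pairs -/

section Pairs

variable {n : ℕ} {M : Type*} [TopologicalSpace M] [ChartedSpace (Cn n) M]

/-- `φ : U → ℂ²ⁿ` is a Kählerian Lagrangian immersion: a holomorphic immersion with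
`φ^*Ω = 0` and `φ^*γ` non-degenerate. -/
structure IsKahlerianLagrangianImmersion {U : TopologicalSpace.Opens M} (φ : U → C2n n) : Prop where
  holomorphic : MDifferentiable 𝓘(ℂ, Cn n) 𝓘(ℂ, C2n n) φ
  immersion : ∀ p : U, Function.Injective (diffOn n φ p)
  lagrangian : ∀ (p : U) (u v : TangentSpace 𝓘(ℝ, Cn n) (p : M)),
    C2n.Omega (diffOn n φ p u) (diffOn n φ p v) = 0
  kahlerian : ∀ (p : U) (u : TangentSpace 𝓘(ℝ, Cn n) (p : M)),
    (∀ v : TangentSpace 𝓘(ℝ, Cn n) (p : M),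
      C2n.gamma (diffOn n φ p u) (diffOn n φ p v) = 0) → u = 0

/-- `φ` induces on `U` the restriction of `(J, g, ∇)` (`J` being the complex structure for which `φ`
is holomorphic): `g = Re φ^*γ`, and `∇` is the pullback along the local diffeomorphism
`Re φ : U → ℝ²ⁿ` of the standard flat connection of `ℝ²ⁿ`, i.e.
`d(Re φ)(∇_u Y) = u (d(Re φ)(Y))`; equivalently the real parts of `zⁱ`, `wᵢ` are
`∇`-affine functions. -/
structure Induces [IsManifold 𝓘(ℂ, Cn n) ω M] (S : AffineSpecialKahler n M)
    {U : TopologicalSpace.Opens M} (φ : U → C2n n) : Prop where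
  metric : ∀ (p : U) (u v : TangentSpace 𝓘(ℝ, Cn n) (p : M)),
    S.g p u v = (C2n.gamma (diffOn n φ p u) (diffOn n φ p v)).re
  connection : ∀ (p : U) (Y : Π q : M, TangentSpace 𝓘(ℝ, Cn n) q),
    MDifferentiableAt 𝓘(ℝ, Cn n) 𝓘(ℝ, Cn n).tangent
      (fun q => (⟨q, Y q⟩ : TangentBundle 𝓘(ℝ, Cn n) M)) (p : M) →
    MDifferentiableAt 𝓘(ℝ, Cn n) 𝓘(ℝ, R2n n) (fun q : U => C2n.re (diffOn n φ q (Y q))) p ∧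
    ∀ u : TangentSpace 𝓘(ℝ, Cn n) (p : M),
      diffOn n (fun q : U => C2n.re (diffOn n φ q (Y q))) p u = C2n.re (diffOn n φ p (S.conn Y p u))

/-- `F : U → ℂ` is a prepotential of `φ`: `dF = φ^*λ`. -/
def IsPrepotential {U : TopologicalSpace.Opens M} (φ : U → C2n n) (F : U → ℂ) : Prop :=
  MDifferentiable 𝓘(ℝ, Cn n) 𝓘(ℝ, ℂ) F ∧
    ∀ (p : U) (u : TangentSpace 𝓘(ℝ, Cn n) (p : M)),
      diffOn n F p u = C2n.liouville (φ p) (diffOn n φ p u)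

/-- The set `ℱ(U)` of special Kähler pairs `(φ, F)` of the open subset `U`. -/
@[ext]
structure SpecialKahlerPair [IsManifold 𝓘(ℂ, Cn n) ω M] (S : AffineSpecialKahler n M)
    (U : TopologicalSpace.Opens M) where
  φ : U → C2n n
  F : U → ℂ
  isKLI : IsKahlerianLagrangianImmersion φ
  induces : Induces S φ
  isPrepotential : IsPrepotential φ F

end Pairs

/-! Well-definedness: a real symplectic `X` preserves `Ω` and commutes with `τ`, hence preserves
`γ`, and it acts affinely on `Re φ`, so `ρ̄(x) ∘ φ` induces the same `g` and `∇`. For the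
prepotential, `λ = -½Ω(q, dq) + ½d(zᵗw)` (`C2n.liouville_eq`): the first term is `Sp`-invariant and
changes under translation by `v` only by the exact form `½dΩ(·, v)`. This dictates the formula for
`x · F`, and the Heisenberg cocycle makes it an action.

Freeness: non-degeneracy of `φ^*γ` makes `d(Re φ)` invertible at each point (`exists_equiv`), so a
stabilizing `X` is the identity; then `v = 0` and `s = 0`.

Transitivity: given `φ` and `ψ`, consider `A = d(Re ψ) ∘ d(Re φ)⁻¹`. Both differentials turn `∇`
into the flat derivative, so the product rule gives `dA = 0` (`hasDiffOn_transition`), and `A` is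
constant on a connected set. It is symplectic because both real parts pull the standard form back to
`½g(·, J·)` (`Induces.omega_reDiff`). Holomorphy recovers `dψ = A dφ` from its real part, whence `ψ
= Aφ + v`; two prepotentials of the same immersion differ by a constant, which `s` absorbs. -/

/-! ### Differentials on an open subset, computed in preferred charts. -/

section DiffOn

open Filter Topology

variable {n : ℕ} {M : Type*} [TopologicalSpace M] [ChartedSpace (Cn n) M]
  {U : TopologicalSpace.Opens M}
  {V : Type*} [NormedAddCommGroup V] [NormedSpace ℝ V]
  {W : Type*} [NormedAddCommGroup W] [NormedSpace ℝ W]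

lemma hasMFDerivAt_iff_chart {𝕜 : Type*} [NontriviallyNormedField 𝕜] {E : Type*}
    [NormedAddCommGroup E] [NormedSpace 𝕜 E] {N : Type*} [TopologicalSpace N] [ChartedSpace E N]
    {V : Type*} [NormedAddCommGroup V] [NormedSpace 𝕜 V] {f : N → V} {x : N} {f' : E →L[𝕜] V} :
    HasMFDerivAt 𝓘(𝕜, E) 𝓘(𝕜, V) f x f' ↔
      HasFDerivAt (f ∘ (chartAt E x).symm) f' (chartAt E x x) := by
  have key : HasFDerivWithinAt (writtenInExtChartAt 𝓘(𝕜, E) 𝓘(𝕜, V) x f) f'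
      (Set.range 𝓘(𝕜, E)) (extChartAt 𝓘(𝕜, E) x x) ↔
      HasFDerivAt (f ∘ (chartAt E x).symm) f' (chartAt E x x) := by
    rw [ModelWithCorners.range_eq_univ, hasFDerivWithinAt_univ]
    rfl
  refine ⟨fun h => key.1 h.2, fun h => ⟨?_, key.2 h⟩⟩
  have h1 := (ContinuousAt.comp (f := chartAt E x) h.continuousAt
    ((chartAt E x).continuousAt (mem_chart_source E x)))
  refine h1.congr ?_
  filter_upwards [(chartAt E x).eventually_left_inverse (mem_chart_source E x)] with y hy
  simp [hy]

lemma mdifferentiableAt_iff_chart {𝕜 : Type*} [NontriviallyNormedField 𝕜] {E : Type*}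
    [NormedAddCommGroup E] [NormedSpace 𝕜 E] {N : Type*} [TopologicalSpace N] [ChartedSpace E N]
    {V : Type*} [NormedAddCommGroup V] [NormedSpace 𝕜 V] {f : N → V} {x : N} :
    MDifferentiableAt 𝓘(𝕜, E) 𝓘(𝕜, V) f x ↔
      DifferentiableAt 𝕜 (f ∘ (chartAt E x).symm) (chartAt E x x) :=
  ⟨fun h => (hasMFDerivAt_iff_chart.1 h.hasMFDerivAt).differentiableAt,
    fun h => (hasMFDerivAt_iff_chart.2 h.hasFDerivAt).mdifferentiableAt⟩

/-- The preferred chart of `U` at `p` is the restriction of that of `M`, so the inclusion reads as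
the identity and the inverse in `diffOn` is harmless. -/
lemma mfderiv_subtypeVal (p : U) :
    mfderiv 𝓘(ℝ, Cn n) 𝓘(ℝ, Cn n) (Subtype.val : U → M) p = ContinuousLinearMap.id ℝ (Cn n) := by
  have h : HasMFDerivAt 𝓘(ℝ, Cn n) 𝓘(ℝ, Cn n) (Subtype.val : U → M) p
      (ContinuousLinearMap.id ℝ (Cn n)) := by
    refine ⟨continuous_subtype_val.continuousAt, ?_⟩
    refine HasFDerivAt.hasFDerivWithinAt ?_
    refine (hasFDerivAt_id _).congr_of_eventuallyEq ?_
    have ht : (chartAt (Cn n) p).target ∈ 𝓝 (chartAt (Cn n) p p) :=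
      (chartAt (Cn n) p).open_target.mem_nhds (mem_chart_target _ p)
    change ∀ᶠ y in 𝓝 (chartAt (Cn n) p p), _
    filter_upwards [ht] with y hy
    exact (chartAt (Cn n) p).right_inv hy
  exact h.mfderiv

/-- `f` has differential `f'` at `p`, read in the preferred chart. -/
def HasDiffOn (f : U → V) (f' : Cn n →L[ℝ] V) (p : U) : Prop :=
  HasFDerivAt (f ∘ (chartAt (Cn n) p).symm) f' (chartAt (Cn n) p p)

lemma diffOn_eq_mfderiv (f : U → V) (p : U) :
    (diffOn n f p : Cn n →L[ℝ] V) = mfderiv 𝓘(ℝ, Cn n) 𝓘(ℝ, V) f p := by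
  have h : diffOn n f p = (mvfderiv 𝓘(ℝ, Cn n) f p : Cn n →L[ℝ] V) ∘L
      (ContinuousLinearMap.id ℝ (Cn n)).inverse :=
    congrArg (fun T : Cn n →L[ℝ] Cn n => (mvfderiv 𝓘(ℝ, Cn n) f p : Cn n →L[ℝ] V) ∘L T.inverse)
      (mfderiv_subtypeVal p)
  rw [h, ContinuousLinearMap.inverse_id]
  rfl

lemma HasDiffOn.diffOn {f : U → V} {f' : Cn n →L[ℝ] V} {p : U} (h : HasDiffOn f f' p) :
    diffOn n f p = f' :=
  (diffOn_eq_mfderiv f p).trans (hasMFDerivAt_iff_chart.2 h).mfderiv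

lemma HasDiffOn.mdifferentiableAt {f : U → V} {f' : Cn n →L[ℝ] V} {p : U} (h : HasDiffOn f f' p) :
    MDifferentiableAt 𝓘(ℝ, Cn n) 𝓘(ℝ, V) f p :=
  (hasMFDerivAt_iff_chart.2 h).mdifferentiableAt

lemma hasDiffOn_of_mdifferentiableAt {f : U → V} {p : U}
    (h : MDifferentiableAt 𝓘(ℝ, Cn n) 𝓘(ℝ, V) f p) : HasDiffOn f (diffOn n f p) p := by
  have := hasMFDerivAt_iff_chart.1 h.hasMFDerivAt
  rw [← diffOn_eq_mfderiv] at this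
  exact this

lemma HasDiffOn.congr {f g : U → V} {f' : Cn n →L[ℝ] V} {p : U} (h : HasDiffOn f f' p)
    (hfg : ∀ q, g q = f q) : HasDiffOn g f' p := by
  rwa [show g = f from funext hfg]

lemma HasDiffOn.comp {f : U → V} {f' : Cn n →L[ℝ] V} {p : U} {g : V → W} {g' : V →L[ℝ] W}
    (hg : HasFDerivAt g g' (f p)) (h : HasDiffOn f f' p) :
    HasDiffOn (fun q => g (f q)) (g' ∘L f') p := by
  refine HasFDerivAt.comp (g := g) (f := f ∘ (chartAt (Cn n) p).symm) _ ?_ h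
  have : (f ∘ (chartAt (Cn n) p).symm) (chartAt (Cn n) p p) = f p := by simp
  rwa [this]

lemma HasDiffOn.clm {f : U → V} {f' : Cn n →L[ℝ] V} {p : U} (T : V →L[ℝ] W)
    (h : HasDiffOn f f' p) : HasDiffOn (fun q => T (f q)) (T ∘L f') p :=
  h.comp T.hasFDerivAt

lemma HasDiffOn.add {f g : U → V} {f' g' : Cn n →L[ℝ] V} {p : U} (hf : HasDiffOn f f' p)
    (hg : HasDiffOn g g' p) : HasDiffOn (fun q => f q + g q) (f' + g') p :=
  HasFDerivAt.add hf hg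

lemma HasDiffOn.sub {f g : U → V} {f' g' : Cn n →L[ℝ] V} {p : U} (hf : HasDiffOn f f' p)
    (hg : HasDiffOn g g' p) : HasDiffOn (fun q => f q - g q) (f' - g') p :=
  HasFDerivAt.sub hf hg

lemma HasDiffOn.add_const {f : U → V} {f' : Cn n →L[ℝ] V} {p : U} (hf : HasDiffOn f f' p)
    (c : V) : HasDiffOn (fun q => f q + c) f' p :=
  HasFDerivAt.add_const c hf

/-- A differentiable function with vanishing differential on a connected open set is constant. -/
lemma eq_of_diffOn_eq_zero [IsManifold 𝓘(ℂ, Cn n) ω M] [PreconnectedSpace U] {f : U → V}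
    (hf : ∀ p : U, HasDiffOn f (0 : Cn n →L[ℝ] V) p) (p q : U) : f p = f q := by
  have : IsManifold 𝓘(ℝ, Cn n) ω M := isManifold_real_of_complex
  have : IsManifold 𝓘(ℝ, Cn n) 1 U := IsManifold.of_le (n := ω) le_top
  refine IsLocallyConstant.apply_eq_of_preconnectedSpace ?_ p q
  rw [IsLocallyConstant.iff_eventually_eq]
  intro x
  set e := chartAt (Cn n) x
  -- The hypothesis speaks at each point of that point's own preferred chart; the chain rule moves
  -- the vanishing to the single chart `e`.
  have hd : ∀ y ∈ e.target, HasFDerivAt (f ∘ e.symm) (0 : Cn n →L[ℝ] V) y := by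
    intro y hy
    have h1 : MDifferentiableAt 𝓘(ℝ, Cn n) 𝓘(ℝ, Cn n) e.symm y :=
      (mdifferentiableOn_atlas_symm (chart_mem_atlas _ x)).mdifferentiableAt
        (e.open_target.mem_nhds hy)
    have h2 : HasMFDerivAt 𝓘(ℝ, Cn n) 𝓘(ℝ, V) f (e.symm y) (0 : Cn n →L[ℝ] V) :=
      hasMFDerivAt_iff_chart.2 (hf (e.symm y))
    have h3 := (HasMFDerivAt.comp y h2 h1.hasMFDerivAt).hasFDerivAt
    have h4 : (0 : Cn n →L[ℝ] V) ∘L (mfderiv 𝓘(ℝ, Cn n) 𝓘(ℝ, Cn n) e.symm y : Cn n →L[ℝ] Cn n)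
        = 0 := ContinuousLinearMap.zero_comp _
    exact h4 ▸ h3
  obtain ⟨r, hr, hball⟩ := Metric.isOpen_iff.1 e.open_target (e x) (mem_chart_target _ x)
  have hcont : ∀ᶠ y in 𝓝 x, e y ∈ Metric.ball (e x) r :=
    (e.continuousAt (mem_chart_source _ x)).eventually (Metric.ball_mem_nhds _ hr)
  filter_upwards [hcont, e.eventually_left_inverse (mem_chart_source _ x)] with y hy hy'
  have := (convex_ball (e x) r).is_const_of_fderivWithin_eq_zero (𝕜 := ℝ) (f := f ∘ e.symm)
    (fun z hz => (hd z (hball hz)).differentiableAt.differentiableWithinAt)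
    (fun z hz => by
      rw [fderivWithin_of_isOpen Metric.isOpen_ball hz, (hd z (hball hz)).fderiv])
    hy (Metric.mem_ball_self hr)
  have hx : e.symm (e x) = x := e.left_inv (mem_chart_source _ x)
  simpa [hy', hx] using this

end DiffOn

/-! ### Linear algebra of `Ω`, `γ` and the real symplectic form. -/

section Algebra

variable {n : ℕ}

namespace C2n

/-- The real part as a continuous linear map. -/
noncomputable def reL (n : ℕ) : C2n n →L[ℝ] R2n n :=
  ContinuousLinearMap.pi fun k => Complex.reCLM ∘L ContinuousLinearMap.proj k

/-- The standard real symplectic form of `ℝ²ⁿ`. -/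
def omega (x y : R2n n) : ℝ := -(x ⬝ᵥ (Matrix.J (Fin n) ℝ).mulVec y)

lemma omega_eq (x y : R2n n) : omega x y =
    ∑ i : Fin n, (x (Sum.inl i) * y (Sum.inr i) - x (Sum.inr i) * y (Sum.inl i)) := by
  simp only [omega, Matrix.J, Matrix.fromBlocks_mulVec, dotProduct, Fintype.sum_sum_type,
    Sum.elim_inl, Sum.elim_inr, Matrix.zero_mulVec, Matrix.neg_mulVec, Matrix.one_mulVec,
    Pi.neg_apply, Function.comp_apply, zero_add, add_zero, Finset.sum_sub_distrib]
  simp [sub_eq_neg_add, add_comm]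

lemma Omega_smul_right (c : ℂ) (a b : C2n n) : Omega a (c • b) = c * Omega a b := by
  simp only [Omega_eq, Matrix.mulVec_smul, dotProduct_smul, smul_eq_mul]; ring

lemma tau_smul (c : ℂ) (a : C2n n) : tau (c • a) = (starRingEnd ℂ) c • tau a := by
  ext k; simp [tau]

lemma Omega_tau (a b : C2n n) : Omega (tau a) (tau b) = (starRingEnd ℂ) (Omega a b) := by
  simp [Omega, tau]

lemma tau_tau (a : C2n n) : tau (tau a) = a := by
  ext k; simp [tau]

/-- For imaginary `a`, `τa = -a`, so `Ω(a, τb)` is minus the conjugate of `Ω(a, b)`. On a Lagrangian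
subspace this puts the kernel of `Re` in the radical of `γ`. -/
lemma gamma_eq_zero_of_re_eq_zero {a b : C2n n} (ha : re a = 0) (h : Omega a b = 0) :
    gamma a b = 0 := by
  have h1 : tau a = -a := by
    ext k
    have := congrFun ha k
    simp only [re, Pi.zero_apply] at this
    apply Complex.ext <;> simp [tau, this]
  have h2 : Omega a (tau b) = 0 := by
    rw [← tau_tau a, Omega_tau, h1, Omega_neg_left, h]
    simp
  rw [gamma, h2, mul_zero]

/-- `γ(a, ib) = Ω(a, τb)`; adding `Ω(a, b) = 0` turns the second argument into `b + τb = 2 Re b`,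
the origin of the factor 2. -/
lemma gamma_I_smul_re {a b : C2n n} (h : Omega a b = 0) :
    (gamma a (Complex.I • b)).re = 2 * omega (re a) (re b) := by
  have h1 : gamma a (Complex.I • b) = Omega a (tau b) + Omega a b := by
    rw [gamma, tau_smul, Omega_smul_right, h, Complex.conj_I, ← mul_assoc]
    simp
  rw [h1, omega_eq]
  simp only [Omega, tau, re, Complex.add_re, Complex.re_sum, Complex.sub_re, Complex.mul_re,
    Complex.conj_re, Complex.conj_im, ← Finset.sum_add_distrib, Finset.mul_sum]
  exact Finset.sum_congr rfl fun i _ => by ring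

lemma ext_of_re {a b : C2n n} (h : re a = re b) (h' : re (Complex.I • a) = re (Complex.I • b)) :
    a = b := by
  ext k
  have h1 := congrFun h k
  have h2 := congrFun h' k
  simp only [re, Pi.smul_apply, smul_eq_mul, Complex.mul_re, Complex.I_re, Complex.I_im, zero_mul,
    one_mul, zero_sub, neg_inj] at h1 h2
  exact Complex.ext h1 h2

/-- Splits `λ` into an `Sp`-invariant part and the exact part `½d(zᵗw)`. -/
lemma liouville_eq (q a : C2n n) : liouville q a = -(1 / 2) * Omega q a +
    1 / 2 * ∑ i : Fin n, (q (Sum.inl i) * a (Sum.inr i) + a (Sum.inl i) * q (Sum.inr i)) := by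
  simp only [liouville, Omega, Finset.mul_sum, ← Finset.sum_add_distrib]
  exact Finset.sum_congr rfl fun i _ => by ring

/-- The differential of `zᵗw` at `q`. -/
noncomputable def dzw (q : C2n n) : C2n n →L[ℝ] ℂ :=
  ∑ i : Fin n, (q (Sum.inl i) • (ContinuousLinearMap.proj (R := ℝ) (φ := fun _ => ℂ) (Sum.inr i))
    + q (Sum.inr i) • (ContinuousLinearMap.proj (R := ℝ) (φ := fun _ => ℂ) (Sum.inl i)))

lemma dzw_apply (q a : C2n n) : dzw q a =
    ∑ i : Fin n, (q (Sum.inl i) * a (Sum.inr i) + a (Sum.inl i) * q (Sum.inr i)) := by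
  simp only [dzw, _root_.sum_apply]
  exact Finset.sum_congr rfl fun i _ => by simp [mul_comm]

lemma hasFDerivAt_zw (q : C2n n) : HasFDerivAt (zw : C2n n → ℂ) (dzw q) q := by
  unfold zw dzw
  exact HasFDerivAt.fun_sum fun i _ =>
    ((ContinuousLinearMap.proj (R := ℝ) (φ := fun _ => ℂ) (Sum.inl i)).hasFDerivAt).mul
      ((ContinuousLinearMap.proj (R := ℝ) (φ := fun _ => ℂ) (Sum.inr i)).hasFDerivAt)

/-- `Ω(·, v)` as a real continuous linear map. -/
noncomputable def OmegaL (v : C2n n) : C2n n →L[ℝ] ℂ :=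
  LinearMap.toContinuousLinearMap
    { toFun := fun a => Omega a v
      map_add' := fun a b => Omega_add_left a b v
      map_smul' := fun c a => by
        simp [Omega, Finset.mul_sum, mul_sub, mul_assoc] }

@[simp] lemma OmegaL_apply (v a : C2n n) : OmegaL v a = Omega a v := rfl

end C2n

/-- `spAct X` as a continuous complex linear map. -/
noncomputable def spActL (X : Matrix.symplecticGroup (Fin n) ℝ) : C2n n →L[ℂ] C2n n :=
  LinearMap.toContinuousLinearMap
    (((X : Matrix (Fin n ⊕ Fin n) (Fin n ⊕ Fin n) ℝ).map Complex.ofReal).mulVecLin)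

lemma re_spAct (X : Matrix.symplecticGroup (Fin n) ℝ) (a : C2n n) :
    C2n.re (spAct X a) = (X : Matrix _ _ ℝ).mulVec (C2n.re a) := by
  ext k
  simp [C2n.re, spAct, Matrix.mulVec, dotProduct]

lemma tau_spAct (X : Matrix.symplecticGroup (Fin n) ℝ) (a : C2n n) :
    C2n.tau (spAct X a) = spAct X (C2n.tau a) := by
  ext k
  simp [C2n.tau, spAct, Matrix.mulVec, dotProduct]

lemma gamma_spAct (X : Matrix.symplecticGroup (Fin n) ℝ) (a b : C2n n) :
    C2n.gamma (spAct X a) (spAct X b) = C2n.gamma a b := by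
  rw [C2n.gamma, tau_spAct, Omega_spAct, C2n.gamma]

lemma spAct_injective (X : Matrix.symplecticGroup (Fin n) ℝ) :
    Function.Injective (spAct X) := by
  intro a b h
  rw [← spAct_one a, ← spAct_one b, ← inv_mul_cancel X, spAct_mul, h, spAct_mul]

lemma mem_symplecticGroup_of_omega {A : Matrix (Fin n ⊕ Fin n) (Fin n ⊕ Fin n) ℝ}
    (h : ∀ x y, C2n.omega (A.mulVec x) (A.mulVec y) = C2n.omega x y) :
    A ∈ Matrix.symplecticGroup (Fin n) ℝ := by
  rw [SymplecticGroup.mem_iff']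
  refine Matrix.ext_iff_mulVec.2 fun y => dotProduct_eq _ _ fun x => ?_
  rw [dotProduct_comm, dotProduct_comm _ x]
  have := h x y
  simp only [C2n.omega, neg_inj] at this
  rw [← this, ← Matrix.vecMul_transpose A x, ← Matrix.dotProduct_mulVec, Matrix.mulVec_mulVec,
    Matrix.mulVec_mulVec]

end Algebra

/-! ### Differentiation of operator-valued maps. -/

section Calculus

/-- In finite dimension an operator is the tuple of its values on a basis. Needed because
`Induces.connection` treats one vector field at a time. -/
lemma differentiableAt_clm_of_apply {D E F : Type*} [NormedAddCommGroup D] [NormedSpace ℝ D]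
    [NormedAddCommGroup E] [NormedSpace ℝ E] [FiniteDimensional ℝ E]
    [NormedAddCommGroup F] [NormedSpace ℝ F] {f : D → E →L[ℝ] F} {x : D}
    (h : ∀ c, DifferentiableAt ℝ (fun y => f y c) x) : DifferentiableAt ℝ f x := by
  let d := Module.finrank ℝ E
  have hd : d = Module.finrank ℝ (Fin d → ℝ) := (Module.finrank_fin_fun ℝ).symm
  let e₁ := ContinuousLinearEquiv.ofFinrankEq hd
  let e₂ := (e₁.arrowCongr (1 : F ≃L[ℝ] F)).trans (ContinuousLinearEquiv.piRing (Fin d))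
  rw [← Function.id_comp f, ← e₂.symm_comp_self]
  exact e₂.symm.differentiableAt.comp x (differentiableAt_pi.mpr fun i => h _)

/-- If `A ∘ B = B'` with `B` invertible and `A ∘ dB = dB'` at `x`, then `dA = 0` at `x`. -/
lemma hasFDerivAt_zero_of_comp_eq {D E F G : Type*} [NormedAddCommGroup D] [NormedSpace ℝ D]
    [NormedAddCommGroup E] [NormedSpace ℝ E] [CompleteSpace E]
    [NormedAddCommGroup F] [NormedSpace ℝ F] [NormedAddCommGroup G] [NormedSpace ℝ G]
    {A : D → F →L[ℝ] G} {B : D → E →L[ℝ] F} {B' : D → E →L[ℝ] G} {x : D}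
    (hAB : ∀ y, A y ∘L B y = B' y) (hB : DifferentiableAt ℝ B x) (hB' : DifferentiableAt ℝ B' x)
    (e : E ≃L[ℝ] F) (he : B x = e)
    (h : ∀ u, A x ∘L fderiv ℝ B x u = fderiv ℝ B' x u) : HasFDerivAt A (0 : D →L[ℝ] F →L[ℝ] G) x := by
  have hinv : DifferentiableAt ℝ (fun y => (B y).inverse) x := by
    refine DifferentiableAt.comp (g := ContinuousLinearMap.inverse) x ?_ hB
    rw [he]
    exact (contDiffAt_map_inverse (n := 1) e).differentiableAt one_ne_zero
  -- Invertible operators form an open set, so near `x` one can solve for `A`; this yields its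
  -- differentiability, which is not assumed.
  have hA : A =ᶠ[nhds x] fun y => B' y ∘L (B y).inverse := by
    have := hB.continuousAt.eventually (he ▸ e.nhds)
    filter_upwards [this] with y ⟨f, hf⟩
    rw [← hAB, ← hf]
    ext v
    simp
  have hdA : DifferentiableAt ℝ A x := (hB'.clm_comp hinv).congr_of_eventuallyEq hA
  have h1 := hdA.hasFDerivAt.clm_comp hB.hasFDerivAt
  have h2 : (fun y => (A y).comp (B y)) = B' := funext hAB
  rw [h2] at h1
  -- Product rule: `dB' = A ∘ dB + dA ∘ B`. By `h` the first term is already `dB'`, so `dA ∘ B = 0`,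
  -- and `B x` is invertible.
  have h3 := hB'.hasFDerivAt.unique h1
  have h4 : fderiv ℝ A x = 0 := by
    ext u v
    have h5 := congrArg (fun T => T u (e.symm v)) h3
    have h6 := congrArg (fun T => T (e.symm v)) (h u)
    simp only [_root_.add_apply, ContinuousLinearMap.comp_apply,
      ContinuousLinearMap.compL_apply, ContinuousLinearMap.flip_apply] at h5 h6
    rw [← h6] at h5
    simpa [he] using h5
  exact h4 ▸ hdA.hasFDerivAt

end Calculus

/-! ### Special Kähler pairs under the group, and the transition map. -/

section Pairs

variable {n : ℕ} {M : Type*} [TopologicalSpace M] [ChartedSpace (Cn n) M]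
  {U : TopologicalSpace.Opens M}

lemma MDifferentiable.exists_hasDiffOn_restrictScalars {φ : U → C2n n}
    (h : MDifferentiable 𝓘(ℂ, Cn n) 𝓘(ℂ, C2n n) φ) (p : U) :
    ∃ T : Cn n →L[ℂ] C2n n, HasDiffOn φ (T.restrictScalars ℝ) p :=
  ⟨_, (mdifferentiableAt_iff_chart.1 (h p)).hasFDerivAt.restrictScalars ℝ⟩

lemma MDifferentiable.hasDiffOn {φ : U → C2n n}
    (h : MDifferentiable 𝓘(ℂ, Cn n) 𝓘(ℂ, C2n n) φ) (p : U) :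
    HasDiffOn φ (diffOn n φ p) p := by
  obtain ⟨T, hT⟩ := h.exists_hasDiffOn_restrictScalars p
  exact hasDiffOn_of_mdifferentiableAt hT.mdifferentiableAt

lemma MDifferentiable.diffOn_cplxJ {φ : U → C2n n}
    (h : MDifferentiable 𝓘(ℂ, Cn n) 𝓘(ℂ, C2n n) φ) (p : U)
    (u : TangentSpace 𝓘(ℝ, Cn n) (p : M)) :
    diffOn n φ p (cplxJ (p : M) u) = Complex.I • diffOn n φ p u := by
  obtain ⟨T, hT⟩ := h.exists_hasDiffOn_restrictScalars p
  rw [hT.diffOn]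
  exact T.map_smul Complex.I (u : Cn n)

/-- The differential of `Re φ` at `p`. -/
noncomputable def reDiff (φ : U → C2n n) (p : U) : Cn n →L[ℝ] R2n n :=
  C2n.reL n ∘L (diffOn n φ p : Cn n →L[ℝ] C2n n)

/-- A vector killed by `d(Re φ)` is in the radical of `φ^*γ`, hence zero; both sides have real
dimension `2n`. -/
lemma IsKahlerianLagrangianImmersion.exists_equiv {φ : U → C2n n}
    (h : IsKahlerianLagrangianImmersion φ) (p : U) :
    ∃ e : Cn n ≃L[ℝ] R2n n, reDiff φ p = e := by
  have hinj : Function.Injective (reDiff φ p : Cn n →ₗ[ℝ] R2n n) := by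
    rw [injective_iff_map_eq_zero]
    intro u hu
    exact h.kahlerian p u fun v => C2n.gamma_eq_zero_of_re_eq_zero hu (h.lagrangian p u v)
  have hrank : Module.finrank ℝ (Cn n) = Module.finrank ℝ (R2n n) := by
    rw [← Module.finrank_mul_finrank ℝ ℂ (Cn n), Complex.finrank_real_complex,
      finrank_euclideanSpace, Module.finrank_fintype_fun_eq_card]
    simp [two_mul]
  exact ⟨(LinearEquiv.ofInjectiveOfFinrankEq _ hinj hrank).toContinuousLinearEquiv, by ext; rfl⟩

lemma IsKahlerianLagrangianImmersion.reDiff_surjective {φ : U → C2n n}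
    (h : IsKahlerianLagrangianImmersion φ) (p : U) : Function.Surjective (reDiff φ p) := by
  obtain ⟨e, he⟩ := h.exists_equiv p
  rw [he]
  exact e.surjective

lemma IsKahlerianLagrangianImmersion.hasDiffOn_rhoBar {φ : U → C2n n}
    (h : IsKahlerianLagrangianImmersion φ) (x : GSK n) (p : U) :
    HasDiffOn (fun q => x.rhoBar (φ q))
      ((spActL x.X).restrictScalars ℝ ∘L (diffOn n φ p : Cn n →L[ℝ] C2n n)) p :=
  ((h.holomorphic.hasDiffOn p).clm ((spActL x.X).restrictScalars ℝ)).add_const x.v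

lemma IsKahlerianLagrangianImmersion.diffOn_rhoBar {φ : U → C2n n}
    (h : IsKahlerianLagrangianImmersion φ) (x : GSK n) (p : U)
    (u : TangentSpace 𝓘(ℝ, Cn n) (p : M)) :
    diffOn n (fun q => x.rhoBar (φ q)) p u = spAct x.X (diffOn n φ p u) := by
  rw [(h.hasDiffOn_rhoBar x p).diffOn]
  rfl

lemma IsKahlerianLagrangianImmersion.rhoBar {φ : U → C2n n}
    (h : IsKahlerianLagrangianImmersion φ) (x : GSK n) :
    IsKahlerianLagrangianImmersion (fun q => x.rhoBar (φ q)) where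
  holomorphic := by
    have : Differentiable ℂ (fun a : C2n n => spActL x.X a + x.v) :=
      (spActL x.X).differentiable.add_const _
    exact this.comp_mdifferentiable h.holomorphic
  immersion p u v huv := by
    rw [h.diffOn_rhoBar, h.diffOn_rhoBar] at huv
    exact h.immersion p (spAct_injective _ huv)
  lagrangian p u v := by
    rw [h.diffOn_rhoBar, h.diffOn_rhoBar, Omega_spAct, h.lagrangian]
  kahlerian p u hu := h.kahlerian p u fun v => by
    simpa only [h.diffOn_rhoBar, gamma_spAct] using hu v

lemma Induces.rhoBar [IsManifold 𝓘(ℂ, Cn n) ω M] {S : AffineSpecialKahler n M} {φ : U → C2n n}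
    (hS : Induces S φ) (h : IsKahlerianLagrangianImmersion φ) (x : GSK n) :
    Induces S (fun q => x.rhoBar (φ q)) where
  metric p u v := by rw [h.diffOn_rhoBar, h.diffOn_rhoBar, gamma_spAct, hS.metric]
  connection p Y hY := by
    obtain ⟨h1, h2⟩ := hS.connection p Y hY
    let T : R2n n →L[ℝ] R2n n :=
      LinearMap.toContinuousLinearMap (x.X : Matrix (Fin n ⊕ Fin n) (Fin n ⊕ Fin n) ℝ).mulVecLin
    have h3 : HasDiffOn (fun q : U => C2n.re (diffOn n (fun q => x.rhoBar (φ q)) q (Y q))) _ p :=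
      ((hasDiffOn_of_mdifferentiableAt h1).clm T).congr fun q => by
        rw [h.diffOn_rhoBar, re_spAct]
        rfl
    refine ⟨h3.mdifferentiableAt, fun u => ?_⟩
    rw [h3.diffOn, h.diffOn_rhoBar, re_spAct, ← h2 u]
    rfl

/-- The transformed prepotential `x · F`. -/
noncomputable def actPrepotential (x : GSK n) (φ : U → C2n n) (F : U → ℂ) (p : U) : ℂ :=
  F p - 1 / 2 * C2n.zw (φ p) + 1 / 2 * C2n.zw (x.rhoBar (φ p))
    + 1 / 2 * C2n.Omega (x.rhoBar (φ p)) x.v - x.s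

lemma IsPrepotential.rhoBar {φ : U → C2n n} {F : U → ℂ} (hF : IsPrepotential φ F)
    (h : IsKahlerianLagrangianImmersion φ) (x : GSK n) :
    IsPrepotential (fun q => x.rhoBar (φ q)) (actPrepotential x φ F) := by
  have key (p : U) : ∃ T : Cn n →L[ℝ] ℂ, HasDiffOn (actPrepotential x φ F) T p ∧
      ∀ u : TangentSpace 𝓘(ℝ, Cn n) (p : M),
        T u = C2n.liouville (x.rhoBar (φ p)) (diffOn n (fun q => x.rhoBar (φ q)) p u) := by
    have hmul : ∀ {f : U → ℂ} {T : Cn n →L[ℝ] ℂ}, HasDiffOn f T p →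
        HasDiffOn (fun q => 1 / 2 * f q) (ContinuousLinearMap.mul ℝ ℂ (1 / 2) ∘L T) p :=
      fun hf => hf.clm (ContinuousLinearMap.mul ℝ ℂ (1 / 2))
    have hφ := h.hasDiffOn_rhoBar x p
    have h1 := hasDiffOn_of_mdifferentiableAt (hF.1 p)
    have h2 := hmul ((h.holomorphic.hasDiffOn p).comp (C2n.hasFDerivAt_zw (φ p)))
    have h3 := hmul (hφ.comp (C2n.hasFDerivAt_zw _))
    have h4 := hmul (hφ.clm (C2n.OmegaL x.v))
    refine ⟨_, (((h1.sub h2).add h3).add h4).add_const (-x.s) |>.congr fun q => ?_, fun u => ?_⟩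
    · simp only [actPrepotential, C2n.OmegaL_apply]
      ring
    · refine Eq.trans ?_ (congrArg (C2n.liouville _) (h.diffOn_rhoBar x p u).symm)
      change diffOn n F p u - 1 / 2 * C2n.dzw (φ p) (diffOn n φ p u)
        + 1 / 2 * C2n.dzw (x.rhoBar (φ p)) (spAct x.X (diffOn n φ p u))
        + 1 / 2 * C2n.Omega (spAct x.X (diffOn n φ p u)) x.v = _
      rw [hF.2 p u, C2n.liouville_eq, C2n.liouville_eq, ← C2n.dzw_apply, ← C2n.dzw_apply]
      -- The translation contributes `Ω(v, X dφ) = -Ω(X dφ, v)`, which the `½Ω(xφ, v)` term of `x ·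
      -- F` compensates.
      have h5 : C2n.Omega (x.rhoBar (φ p)) (spAct x.X (diffOn n φ p u)) =
          C2n.Omega (φ p) (diffOn n φ p u) - C2n.Omega (spAct x.X (diffOn n φ p u)) x.v := by
        rw [GSK.rhoBar, C2n.Omega_add_left, Omega_spAct, sub_eq_add_neg, add_right_inj]
        simp only [C2n.Omega, ← Finset.sum_neg_distrib]
        exact Finset.sum_congr rfl fun i _ => by ring
      rw [h5]
      ring
  refine ⟨fun p => ?_, fun p u => ?_⟩
  · obtain ⟨T, hT, -⟩ := key p
    exact hT.mdifferentiableAt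
  · obtain ⟨T, hT, hT'⟩ := key p
    rw [hT.diffOn]
    exact hT' u

/-- The linear part of the transition from the affine chart `Re φ` to `Re ψ`. -/
noncomputable def transition (φ ψ : U → C2n n) (p : U) : R2n n →L[ℝ] R2n n :=
  reDiff ψ p ∘L (reDiff φ p).inverse

lemma transition_comp {φ : U → C2n n} (hφ : IsKahlerianLagrangianImmersion φ) (ψ : U → C2n n)
    (p : U) : transition φ ψ p ∘L reDiff φ p = reDiff ψ p := by
  obtain ⟨e, he⟩ := hφ.exists_equiv p
  ext1 u
  simp [transition, he]

end Pairs

/-! ### Rigidity: immersions inducing the same structure on a connected set. -/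

section Transition

variable {n : ℕ} {M : Type*} [TopologicalSpace M] [ChartedSpace (Cn n) M]
  [IsManifold 𝓘(ℂ, Cn n) ω M] {S : AffineSpecialKahler n M} {U : TopologicalSpace.Opens M}

/-- The identity of `T_p M`, extended to a field of linear maps `T_p M → T_q M` by means of the
preferred trivialization at `p`. -/
noncomputable def frameAt (p q : M) : Cn n →L[ℝ] TangentSpace 𝓘(ℝ, Cn n) q :=
  ((trivializationAt (Cn n) (TangentSpace 𝓘(ℝ, Cn n)) p).symmL ℝ q) ∘L
    ((trivializationAt (Cn n) (TangentSpace 𝓘(ℝ, Cn n)) p).continuousLinearMapAt ℝ p)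

lemma frameAt_self (p : M) (c : TangentSpace 𝓘(ℝ, Cn n) p) : frameAt p p c = c :=
  (trivializationAt (Cn n) (TangentSpace 𝓘(ℝ, Cn n)) p).symmL_continuousLinearMapAt
    (FiberBundle.mem_baseSet_trivializationAt' p) c

lemma mdifferentiableAt_frameAt (p : M) (c : Cn n) :
    MDifferentiableAt 𝓘(ℝ, Cn n) 𝓘(ℝ, Cn n).tangent
      (fun q => (⟨q, frameAt p q c⟩ : TangentBundle 𝓘(ℝ, Cn n) M)) p := by
  have : IsManifold 𝓘(ℝ, Cn n) ω M := isManifold_real_of_complex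
  have : IsManifold 𝓘(ℝ, Cn n) 1 M := IsManifold.of_le (n := ω) le_top
  have h := FiberBundle.mdifferentiableAt_extend 𝓘(ℝ, Cn n) (Cn n)
    (V := (TangentSpace 𝓘(ℝ, Cn n) : M → Type _)) (x := p) c
  refine h.congr_of_eventuallyEq ?_
  filter_upwards [(trivializationAt (Cn n) (TangentSpace 𝓘(ℝ, Cn n)) p).open_baseSet.mem_nhds
    (FiberBundle.mem_baseSet_trivializationAt' p)] with q hq
  congr 1
  refine ((trivializationAt (Cn n) (TangentSpace 𝓘(ℝ, Cn n)) p).symmL_apply hq _).trans ?_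
  exact congrArg _ ((trivializationAt (Cn n) (TangentSpace 𝓘(ℝ, Cn n)) p
    ).continuousLinearMapAt_apply_of_mem (R := ℝ) (FiberBundle.mem_baseSet_trivializationAt' p) c)

/-- The differential of `Re φ`, read in the frame at `p`. -/
noncomputable def reDiffFrame (φ : U → C2n n) (p q : U) : Cn n →L[ℝ] R2n n :=
  reDiff φ q ∘L (frameAt (p : M) (q : M) : Cn n →L[ℝ] Cn n)

lemma reDiffFrame_self (φ : U → C2n n) (p : U) : reDiffFrame φ p p = reDiff φ p := by
  ext1 c
  exact congrArg (reDiff φ p) (frameAt_self (p : M) c)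

lemma Induces.hasDiffOn_reDiffFrame_apply {φ : U → C2n n} (h : Induces S φ) (p : U) (c : Cn n) :
    HasDiffOn (fun q => reDiffFrame φ p q c)
      (diffOn n (fun q => reDiffFrame φ p q c) p) p ∧
    ∀ u : Cn n, (diffOn n (fun q => reDiffFrame φ p q c) p : Cn n →L[ℝ] R2n n) u =
      reDiff φ p (S.conn (fun q => frameAt (p : M) q c) p u) := by
  obtain ⟨h1, h2⟩ := h.connection p _ (mdifferentiableAt_frameAt (p : M) c)
  exact ⟨hasDiffOn_of_mdifferentiableAt h1, h2⟩

lemma Induces.differentiableAt_reDiffFrame {φ : U → C2n n} (h : Induces S φ) (p : U) :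
    DifferentiableAt ℝ (reDiffFrame φ p ∘ (chartAt (Cn n) p).symm) (chartAt (Cn n) p p) :=
  differentiableAt_clm_of_apply fun c => HasFDerivAt.differentiableAt
    (h.hasDiffOn_reDiffFrame_apply p c).1

lemma Induces.fderiv_reDiffFrame {φ : U → C2n n} (h : Induces S φ) (p : U) (u c : Cn n) :
    fderiv ℝ (reDiffFrame φ p ∘ (chartAt (Cn n) p).symm) (chartAt (Cn n) p p) u c =
      reDiff φ p (S.conn (fun q => frameAt (p : M) q c) p u) := by
  have h1 := (h.differentiableAt_reDiffFrame p).hasFDerivAt.clm_apply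
    (hasFDerivAt_const c (chartAt (Cn n) p p))
  obtain ⟨h2, h3⟩ := h.hasDiffOn_reDiffFrame_apply p c
  have h4 := congrArg (fun T => T u) (HasFDerivAt.unique h1 h2)
  refine Eq.trans ?_ (h4.trans (h3 u))
  simp

/-- In the frame at `p`, the derivatives of `d(Re φ)` and `d(Re ψ)` are the images of the same
vectors `∇_u Y`, so `transition φ ψ p` intertwines them and its own derivative must vanish. -/
lemma hasDiffOn_transition {φ ψ : U → C2n n} (hφ : IsKahlerianLagrangianImmersion φ)
    (hSφ : Induces S φ) (hSψ : Induces S ψ) (p : U) :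
    HasDiffOn (transition φ ψ) (0 : Cn n →L[ℝ] R2n n →L[ℝ] R2n n) p := by
  obtain ⟨e, he⟩ := hφ.exists_equiv p
  have hp : (chartAt (Cn n) p).symm (chartAt (Cn n) p p) = p :=
    (chartAt (Cn n) p).left_inv (mem_chart_source _ p)
  refine hasFDerivAt_zero_of_comp_eq (B := reDiffFrame φ p ∘ (chartAt (Cn n) p).symm)
    (B' := reDiffFrame ψ p ∘ (chartAt (Cn n) p).symm) (fun y => ?_)
    (hSφ.differentiableAt_reDiffFrame p) (hSψ.differentiableAt_reDiffFrame p) e ?_ (fun u => ?_)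
  · exact congrArg (fun T : Cn n →L[ℝ] R2n n => T ∘L
      (frameAt (p : M) ((chartAt (Cn n) p).symm y : U) : Cn n →L[ℝ] Cn n))
      (transition_comp hφ ψ ((chartAt (Cn n) p).symm y))
  · rw [Function.comp_apply, hp, reDiffFrame_self, he]
  · ext1 c
    rw [Function.comp_apply, hp, ContinuousLinearMap.comp_apply, hSφ.fderiv_reDiffFrame,
      hSψ.fderiv_reDiffFrame, ← transition_comp hφ ψ p]
    rfl

/-- The right side depends only on `S`; comparing two immersions shows that their transition map is
symplectic. -/
lemma Induces.omega_reDiff {φ : U → C2n n} (h : Induces S φ)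
    (hφ : IsKahlerianLagrangianImmersion φ) (p : U) (u v : TangentSpace 𝓘(ℝ, Cn n) (p : M)) :
    2 * C2n.omega (reDiff φ p u) (reDiff φ p v) = S.g p u (cplxJ (p : M) v) := by
  rw [h.metric, hφ.holomorphic.diffOn_cplxJ, C2n.gamma_I_smul_re (hφ.lagrangian p u v)]
  rfl

/-- Two immersions inducing the same special Kähler structure on a connected open set differ by
a real symplectic transformation and a translation. -/
lemma exists_spAct_add {φ ψ : U → C2n n} [PreconnectedSpace U] [Nonempty U]
    (hφ : IsKahlerianLagrangianImmersion φ) (hψ : IsKahlerianLagrangianImmersion ψ)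
    (hSφ : Induces S φ) (hSψ : Induces S ψ) :
    ∃ (X : Matrix.symplecticGroup (Fin n) ℝ) (v : C2n n), ∀ p, ψ p = spAct X (φ p) + v := by
  obtain ⟨p₀⟩ := ‹Nonempty U›
  set A := (transition φ ψ p₀ : R2n n →ₗ[ℝ] R2n n).toMatrix' with hA
  have hre : ∀ (p : U) (u : Cn n), reDiff ψ p u = A.mulVec (reDiff φ p u) := by
    intro p u
    rw [← transition_comp hφ ψ p,
      eq_of_diffOn_eq_zero (fun q => hasDiffOn_transition hφ hSφ hSψ q) p p₀, hA,
      ← Matrix.toLin'_apply, Matrix.toLin'_toMatrix']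
    rfl
  have hAmem : A ∈ Matrix.symplecticGroup (Fin n) ℝ := by
    refine mem_symplecticGroup_of_omega fun x y => ?_
    obtain ⟨u, rfl⟩ := hφ.reDiff_surjective p₀ x
    obtain ⟨v, rfl⟩ := hφ.reDiff_surjective p₀ y
    rw [← hre, ← hre]
    have h1 := hSφ.omega_reDiff hφ p₀ u v
    have h2 := hSψ.omega_reDiff hψ p₀ u v
    linarith
  let X : Matrix.symplecticGroup (Fin n) ℝ := ⟨A, hAmem⟩
  have hd : ∀ (p : U) (u : TangentSpace 𝓘(ℝ, Cn n) (p : M)),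
      diffOn n ψ p u = spAct X (diffOn n φ p u) := by
    intro p u
    have h1 : ∀ u : TangentSpace 𝓘(ℝ, Cn n) (p : M),
        C2n.re (diffOn n ψ p u) = C2n.re (spAct X (diffOn n φ p u)) := fun u => by
      rw [re_spAct]
      exact hre p u
    -- Both sides are complex linear in `u`, and `Re(ia) = -Im a`: comparing real parts at `u` and
    -- at `Ju` suffices.
    refine C2n.ext_of_re (h1 u) ?_
    have h2 := h1 (cplxJ (p : M) u)
    rw [hψ.holomorphic.diffOn_cplxJ, hφ.holomorphic.diffOn_cplxJ] at h2
    rw [h2]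
    exact congrArg C2n.re ((spActL X).map_smul Complex.I _)
  have hzero : ∀ p : U, HasDiffOn (fun q => ψ q - spAct X (φ q)) (0 : Cn n →L[ℝ] C2n n) p := by
    intro p
    have h1 := (hψ.holomorphic.hasDiffOn p).sub
      ((hφ.holomorphic.hasDiffOn p).clm ((spActL X).restrictScalars ℝ))
    have h2 : (diffOn n ψ p : Cn n →L[ℝ] C2n n) -
        (spActL X).restrictScalars ℝ ∘L (diffOn n φ p : Cn n →L[ℝ] C2n n) = 0 := by
      ext1 u
      exact sub_eq_zero.2 (hd p u)
    exact h2 ▸ h1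
  exact ⟨X, ψ p₀ - spAct X (φ p₀), fun p =>
    sub_eq_iff_eq_add'.1 (eq_of_diffOn_eq_zero hzero p p₀)⟩

lemma IsPrepotential.exists_eq_add_const {φ : U → C2n n} {F G : U → ℂ} [PreconnectedSpace U]
    [Nonempty U] (hF : IsPrepotential φ F) (hG : IsPrepotential φ G) :
    ∃ s : ℂ, ∀ p, G p = F p + s := by
  obtain ⟨p₀⟩ := ‹Nonempty U›
  have hzero : ∀ p : U, HasDiffOn (fun q => G q - F q) (0 : Cn n →L[ℝ] ℂ) p := by
    intro p
    have h1 := (hasDiffOn_of_mdifferentiableAt (hG.1 p)).sub (hasDiffOn_of_mdifferentiableAt (hF.1 p))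
    have h2 : (diffOn n G p : Cn n →L[ℝ] ℂ) - (diffOn n F p : Cn n →L[ℝ] ℂ) = 0 := by
      ext1 u
      exact sub_eq_zero.2 ((hG.2 p u).trans (hF.2 p u).symm)
    exact h2 ▸ h1
  exact ⟨G p₀ - F p₀, fun p => sub_eq_iff_eq_add'.1 (eq_of_diffOn_eq_zero hzero p p₀)⟩

end Transition

/-! ### The action, its freeness and its transitivity. -/

section Action

variable {n : ℕ} {M : Type*} [TopologicalSpace M] [ChartedSpace (Cn n) M]
  [IsManifold 𝓘(ℂ, Cn n) ω M] {S : AffineSpecialKahler n M} {U : TopologicalSpace.Opens M}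

lemma GSK.rhoBar_mul (x y : GSK n) (q : C2n n) : (x * y).rhoBar q = x.rhoBar (y.rhoBar q) := by
  simp only [GSK.rhoBar, GSK.mul_def, spAct_mul, spAct_add, add_assoc]

lemma GSK.rhoBar_one (q : C2n n) : (1 : GSK n).rhoBar q = q := by
  simp only [GSK.rhoBar, GSK.one_def, spAct_one, add_zero]

namespace SpecialKahlerPair

/-- The action of `G_SK` on special Kähler pairs. -/
noncomputable instance : MulAction (GSK n) (SpecialKahlerPair S U) where
  smul x P :=
    { φ := fun p => x.rhoBar (P.φ p)
      F := actPrepotential x P.φ P.F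
      isKLI := P.isKLI.rhoBar x
      induces := P.induces.rhoBar P.isKLI x
      isPrepotential := P.isPrepotential.rhoBar P.isKLI x }
  one_smul P := by
    refine SpecialKahlerPair.ext (funext fun p => GSK.rhoBar_one _) (funext fun p => ?_)
    change actPrepotential 1 P.φ P.F p = P.F p
    rw [actPrepotential, GSK.rhoBar_one]
    simp [GSK.one_def, C2n.Omega]
  mul_smul x y P := by
    refine SpecialKahlerPair.ext (funext fun p => GSK.rhoBar_mul x y _) (funext fun p => ?_)
    change actPrepotential (x * y) P.φ P.F p =
      actPrepotential x (fun p => y.rhoBar (P.φ p)) (actPrepotential y P.φ P.F) p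
    simp only [actPrepotential, GSK.rhoBar_mul]
    -- The intermediate `zᵗw` terms telescope, and the cross term `½Ω(v, Xv')` from the two
    -- translations cancels the cocycle in the `s`-component of the product.
    simp only [GSK.mul_def, GSK.rhoBar, spAct_add, C2n.Omega_add_left, C2n.Omega_add_right,
      Omega_spAct, C2n.Omega_self]
    have h : C2n.Omega x.v (spAct x.X y.v) = -C2n.Omega (spAct x.X y.v) x.v := by
      simp only [C2n.Omega, ← Finset.sum_neg_distrib]
      exact Finset.sum_congr rfl fun i _ => by ring
    rw [h]
    ring

lemma smul_F (x : GSK n) (P : SpecialKahlerPair S U) (p : U) :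
    (x • P).F p = actPrepotential x P.φ P.F p := rfl

/-- The action of `G_SK` on special Kähler pairs of a non-empty open set is free. -/
lemma eq_one_of_smul_eq [Nonempty U] {x : GSK n} {P : SpecialKahlerPair S U} (h : x • P = P) :
    x = 1 := by
  obtain ⟨p⟩ := ‹Nonempty U›
  have hφ : (fun q => x.rhoBar (P.φ q)) = P.φ := congrArg SpecialKahlerPair.φ h
  have hX : x.X = 1 := by
    refine Subtype.ext (Matrix.ext_iff_mulVec.2 fun w => ?_)
    -- Differentiating `xφ = φ` gives `X dφ = dφ`; the real parts of `dφ` fill `ℝ²ⁿ`, so one point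
    -- determines `X`.
    obtain ⟨u, rfl⟩ := P.isKLI.reDiff_surjective p w
    have h1 := P.isKLI.diffOn_rhoBar x p u
    rw [hφ] at h1
    have h2 := congrArg C2n.re h1
    rw [re_spAct] at h2
    rw [OneMemClass.coe_one, Matrix.one_mulVec]
    exact h2.symm
  have hv : x.v = 0 := by
    have h1 := congrFun hφ p
    simpa [GSK.rhoBar, hX, spAct_one] using h1
  have hs : x.s = 0 := by
    have h1 : actPrepotential x P.φ P.F p = P.F p := congrFun (congrArg SpecialKahlerPair.F h) p
    rw [actPrepotential, show x.rhoBar (P.φ p) = P.φ p from congrFun hφ p, hv] at h1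
    simpa [C2n.Omega] using h1
  exact GSK.ext hX hs hv

/-- The action of `G_SK` on special Kähler pairs of a non-empty connected open set is
transitive. -/
lemma exists_smul_eq [PreconnectedSpace U] [Nonempty U] (P Q : SpecialKahlerPair S U) :
    ∃ x : GSK n, x • P = Q := by
  obtain ⟨X, v, hXv⟩ := exists_spAct_add P.isKLI Q.isKLI P.induces Q.induces
  -- `ρ̄` ignores the central coordinate, so it is set to `0` here and adjusted once the
  -- prepotentials are compared.
  have hφ : ((⟨X, 0, v⟩ : GSK n) • P).φ = Q.φ := funext fun p => (hXv p).symm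
  obtain ⟨s, hs⟩ := IsPrepotential.exists_eq_add_const
    (hφ ▸ ((⟨X, 0, v⟩ : GSK n) • P).isPrepotential) Q.isPrepotential
  -- The sign is negative because `x · F` subtracts the central coordinate.
  refine ⟨⟨X, -s, v⟩, SpecialKahlerPair.ext hφ (funext fun p => ?_)⟩
  rw [hs p, smul_F, smul_F]
  simp only [actPrepotential, GSK.rhoBar]
  ring

end SpecialKahlerPair

end Action
theorem mainTheorem6 (n : ℕ) (M : Type*) [TopologicalSpace M] [T2Space M]
    [SecondCountableTopology M] [ConnectedSpace M] [ChartedSpace (Cn n) M]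
    [IsManifold 𝓘(ℂ, Cn n) ω M] (S : AffineSpecialKahler n M)
    (U : TopologicalSpace.Opens M) (hne : Nonempty (SpecialKahlerPair S U)) :
    ∃ _ : MulAction (GSK n) (SpecialKahlerPair S U),
      (∀ (x : GSK n) (P : SpecialKahlerPair S U),
        (∀ p : U, (x • P).φ p = x.rhoBar (P.φ p)) ∧
        (∀ p : U, (x • P).F p = P.F p - 1 / 2 * C2n.zw (P.φ p)
          + 1 / 2 * C2n.zw (x.rhoBar (P.φ p))
          + 1 / 2 * C2n.Omega (x.rhoBar (P.φ p)) x.v - x.s)) ∧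
      ((U : Set M).Nonempty →
        ∀ (x : GSK n) (P : SpecialKahlerPair S U), x • P = P → x = 1) ∧
      (IsConnected (U : Set M) →
        ∀ P Q : SpecialKahlerPair S U, ∃! x : GSK n, x • P = Q) := by
  refine ⟨inferInstance, fun x P => ⟨fun p => rfl, fun p => rfl⟩, fun hU x P h => ?_,
    fun hU P Q => ?_⟩
  · have : Nonempty U := hU.to_subtype
    exact SpecialKahlerPair.eq_one_of_smul_eq h
  · have : Nonempty U := hU.nonempty.to_subtype
    have : PreconnectedSpace U := isPreconnected_iff_preconnectedSpace.1 hU.isPreconnected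
    obtain ⟨x, hx⟩ := SpecialKahlerPair.exists_smul_eq P Q
    refine ⟨x, hx, fun y hy => ?_⟩
    have h : (x⁻¹ * y) • P = P := by rw [mul_smul, inv_smul_eq_iff]; exact hy.trans hx.symm
    exact (inv_mul_eq_one.1 (SpecialKahlerPair.eq_one_of_smul_eq h)).symm
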